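/- Let $K$ be an algebraically closed field, $Q$ a finite quiver, and $G$ a finite abelian group whose order is invertible in $K$. Let $G$ act on the path algebra $KQ$ by $K$-algebra automorphisms that permute the vertices and map the span of the arrows $i\to j$ to the span of the arrows $gi\to gj$, and assume that every vertex whose stabilizer is not all of $G$ has an orbit with $|G|$ elements. Let $\Lambda=KQ/I$ for a $G$-stable admissible ideal $I$ (so $I=0$ is allowed if $KQ$ is finite-dimensional), with the induced action, and let $\Lambda G$ be the skew group algebra: $\Lambda\otimes_K KG$ with $(\lambda\otimes g)(\mu\otimes h)=\lambda g(\mu)\otimes gh$. Let $\mathrm{mod}\text{-}\Lambda$ and $\mathrm{mod}\text{-}\Lambda G$ be the categories of finitely generated modules, where a $\Lambda$-module $M$ is viewed as a representation $(M(i),M(\alpha))$ of $Q$; in terms of algebras, arrows are composed from right to left and modules are left modules. For $g\in G$ let ${}^gM$ be the $\Lambda$-module with ${}^gM(i)=M(gi)$ and ${}^gM(\alpha)=M(g\alpha)$, that is, $M$ with $\lambda\in\Lambda$ acting as $g(\lambda)$; let $G_M=\{g\in G: {}^gM\cong M\}$ and $G_{MN}=G_M\cap G_N$. The pushdown functor $F_\lambda:\mathrm{mod}\text{-}\Lambda\to\mathrm{mod}\text{-}\Lambda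 G$ sends $M$ to $\bigoplus_{g\in G}M$, with the action $$\big((\lambda\otimes h)\mu\big)_g=g(\lambda)\,\mu_{gh},\qquad \mu=(\mu_g)_{g\in G},$$ and a morphism $f$ to $f$ in each component. Thus its value at $e_i\otimes 1$, for a vertex $i$, is $\bigoplus_{g\in G}M(gi)$, and for an arrow $\alpha: i\to j$ the element $\alpha\otimes1$ acts by $(\mu_g)\mapsto(M(g\alpha)\mu_g)$. Let $\iota_{g,M}:F_\lambda M\to F_\lambda({}^gM)$ be the isomorphism $(\mu_k)_k\mapsto(\mu_{gk})_k$ that permutes the summands. Then for all $M,N\in\mathrm{mod}\text{-}\Lambda$ the functor $F_\lambda$ induces isomorphisms of $K$-vector spaces $$\mathrm{Hom}_{\Lambda G}(F_\lambda M,F_\lambda N)\cong\begin{cases}\bigoplus_{g\in G}\mathrm{Hom}_\Lambda({}^gM,N)&\text{if }G_M\ne G,\\ \bigoplus_{g\in G}\mathrm{Hom}_\Lambda(M,{}^gN)&\text{if }G_N\ne G,\\ \bigoplus_{g\in G}\mathrm{Hom}_\Lambda(M,N)&\text{if }G_{MN}=G,\end{cases}$$ given, from right to left, by $(f_g)\mapsto\sum_g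 F_\lambda(f_g)\,\iota_{g,M}$ in the first case, by $(f_g)\mapsto\sum_g\iota_{g,N}^{-1}F_\lambda(f_g)$ in the second, and in the third by $(f_g)\mapsto\sum_gF_\lambda(f_g\theta_g)\,\iota_{g,M}$ for suitable isomorphisms $\theta_g:{}^gM\to M$. In particular $F_\lambda$ is a Galois semi-covering functor: it is $K$-linear, and for all $M,N$ there is an isomorphism of vector spaces $\mathrm{Hom}_{\Lambda G}(F_\lambda M,F_\lambda N)\cong\bigoplus_{g}\mathrm{Hom}_\Lambda({}^gM,N)$ if $G_M\neq G$ or $G_N=G$, and $\mathrm{Hom}_{\Lambda G}(F_\lambda M,F_\lambda N)\cong\bigoplus_{g}\mathrm{Hom}_\Lambda(M,{}^gN)$ if $G_N\ne G$ or $G_M=G$. -/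

import Mathlib

open CategoryTheory
open scoped DirectSum

universe v w u a

noncomputable section

/-! ### Path algebras of finite quivers -/

section PathAlgebra

variable (K : Type*) [Field K] (Q : Type*) [Fintype Q] [Quiver.{a + 1} Q]

/-- The defining relations of the path algebra on the generators `e_i` (one for each vertex) and
`a` (one for each arrow): the `e_i` are orthogonal idempotents with sum `1`, and
`a e_i = a = e_j a` for an arrow `a : i ⟶ j`. Arrows are composed from right to left, so a left
module `M` is the same thing as a representation `M(i) = e_i M`, `M(a) : M(i) → M(j)`. -/
inductive PathAlgebra.Rel :
    FreeAlgebra K (Q ⊕ (Σ i j : Q, (i ⟶ j))) → FreeAlgebra K (Q ⊕ (Σ i j : Q, (i ⟶ j))) → Prop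
  | idem (i : Q) : PathAlgebra.Rel
      (FreeAlgebra.ι K (Sum.inl i) * FreeAlgebra.ι K (Sum.inl i)) (FreeAlgebra.ι K (Sum.inl i))
  | orth (i j : Q) (h : i ≠ j) : PathAlgebra.Rel
      (FreeAlgebra.ι K (Sum.inl i) * FreeAlgebra.ι K (Sum.inl j)) 0
  | source {i j : Q} (a : i ⟶ j) : PathAlgebra.Rel
      (FreeAlgebra.ι K (Sum.inr ⟨i, j, a⟩) * FreeAlgebra.ι K (Sum.inl i))
      (FreeAlgebra.ι K (Sum.inr ⟨i, j, a⟩))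
  | target {i j : Q} (a : i ⟶ j) : PathAlgebra.Rel
      (FreeAlgebra.ι K (Sum.inl j) * FreeAlgebra.ι K (Sum.inr ⟨i, j, a⟩))
      (FreeAlgebra.ι K (Sum.inr ⟨i, j, a⟩))
  | one : PathAlgebra.Rel (∑ i : Q, FreeAlgebra.ι K (Sum.inl i)) 1

/-- The path algebra `KQ` of a quiver `Q` with finitely many vertices. -/
def PathAlgebra : Type _ := RingQuot (PathAlgebra.Rel K Q)

namespace PathAlgebra

instance : Ring (PathAlgebra K Q) := inferInstanceAs (Ring (RingQuot (PathAlgebra.Rel K Q)))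

instance : Algebra K (PathAlgebra K Q) :=
  inferInstanceAs (Algebra K (RingQuot (PathAlgebra.Rel K Q)))

variable {Q}

/-- The idempotent `e_i` (the trivial path) at the vertex `i`. -/
def vertex (i : Q) : PathAlgebra K Q :=
  RingQuot.mkAlgHom K (PathAlgebra.Rel K Q) (FreeAlgebra.ι K (Sum.inl i))

/-- The arrow `a`, as an element of `KQ`. -/
def arrow {i j : Q} (a : i ⟶ j) : PathAlgebra K Q :=
  RingQuot.mkAlgHom K (PathAlgebra.Rel K Q) (FreeAlgebra.ι K (Sum.inr ⟨i, j, a⟩))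

/-- The space spanned by the arrows from `i` to `j`. -/
def arrowSpan (i j : Q) : Submodule K (PathAlgebra K Q) :=
  Submodule.span K (Set.range fun a : i ⟶ j => arrow K a)

variable (Q)

/-- The `m`-th power of the arrow ideal: the two-sided ideal generated by the products of
`m` arrows. -/
def arrowIdealPow (m : ℕ) : TwoSidedIdeal (PathAlgebra K Q) :=
  TwoSidedIdeal.span {x | ∃ l : List (Σ i j : Q, (i ⟶ j)), l.length = m ∧
    x = (l.map fun a => arrow K a.2.2).prod}

variable {K Q} in
/-- An ideal `I` of `KQ` is admissible if `R ^ m ⊆ I ⊆ R ^ 2` for some `m ≥ 2`, where `R` is the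
arrow ideal. (If `KQ` is finite-dimensional, then `I = 0` is admissible.) -/
def IsAdmissible (I : TwoSidedIdeal (PathAlgebra K Q)) : Prop :=
  I ≤ arrowIdealPow K Q 2 ∧ ∃ m : ℕ, 2 ≤ m ∧ arrowIdealPow K Q m ≤ I

/-- The assumptions on the action of `G` on `KQ`: it permutes the vertices, it maps the
span of the arrows `i ⟶ j` to the span of the arrows `g i ⟶ g j`, and the orbit of a vertex that
is not fixed by all of `G` has `|G|` elements. -/
structure IsQuiverAction (G : Type*) [Group G] [MulAction G Q]
    [MulSemiringAction G (PathAlgebra K Q)] : Prop where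
  smul_vertex : ∀ (g : G) (i : Q), g • vertex K i = vertex K (g • i)
  smul_arrow : ∀ (g : G) {i j : Q} (a : i ⟶ j), g • arrow K a ∈ arrowSpan K (g • i) (g • j)
  card_orbit : ∀ i : Q, MulAction.stabilizer G i ≠ ⊤ →
    Nat.card (MulAction.orbit G i) = Nat.card G

end PathAlgebra

end PathAlgebra

/-! ### Group actions on linear categories and Galois semi-coverings -/

section SemiCovering

variable (K : Type*) [Field K]

/-- An action of a group `G` on a `K`-linear category by `K`-linear autoequivalences `X ↦ gX`,
with coherent isomorphisms `1X ≅ X` and `(gh)X ≅ g(hX)`. -/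
structure LinearCatAction (G : Type*) [Group G] (A : Type*) [Category A] [Preadditive A]
    [Linear K A] where
  functor : G → A ⥤ A
  additive : ∀ g, (functor g).Additive
  linear : ∀ g, (functor g).Linear K
  oneIso : functor 1 ≅ 𝟭 A
  mulIso : ∀ {g h k : G}, g * h = k → (functor k ≅ functor h ⋙ functor g)
  one_mul : ∀ (g : G) (X : A), (mulIso (one_mul g)).hom.app X ≫ oneIso.hom.app _ = 𝟙 _
  mul_one : ∀ (g : G) (X : A),
    (mulIso (mul_one g)).hom.app X ≫ (functor g).map (oneIso.hom.app X) = 𝟙 _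
  mul_assoc : ∀ {a b c ab bc abc : G} (h₁ : a * b = ab) (h₂ : b * c = bc) (h₃ : ab * c = abc)
    (h₄ : a * bc = abc) (X : A),
    (mulIso h₃).hom.app X ≫ (mulIso h₁).hom.app ((functor c).obj X) =
      (mulIso h₄).hom.app X ≫ (functor a).map ((mulIso h₂).hom.app X)

variable {K} {G : Type*} [Group G] {A : Type*} [Category A] [Preadditive A] [Linear K A]

/-- The stabilizer `G_X = {g | gX ≅ X}` of an object. -/
def LinearCatAction.stabilizer (T : LinearCatAction K G A) (X : A) : Subgroup G where
  carrier := {g | Nonempty ((T.functor g).obj X ≅ X)}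
  one_mem' := ⟨T.oneIso.app X⟩
  mul_mem' := by
    rintro g h ⟨a⟩ ⟨b⟩
    exact ⟨(T.mulIso rfl).app X ≪≫ (T.functor g).mapIso b ≪≫ a⟩
  inv_mem' := by
    rintro g ⟨a⟩
    exact ⟨(T.functor g⁻¹).mapIso a.symm ≪≫ ((T.mulIso (inv_mul_cancel g)).app X).symm ≪≫
      T.oneIso.app X⟩

/-- A functor `F : A ⥤ B` between `K`-linear categories, where `G` acts on `A`, is a Galois
semi-covering functor if `B(FX, FY) ≅ ⨁_g A(gX, Y)` whenever `G_X ≠ G` or `G_Y = G`, and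
`B(FX, FY) ≅ ⨁_g A(X, gY)` whenever `G_Y ≠ G` or `G_X = G`, as vector spaces. -/
structure IsGaloisSemiCovering (T : LinearCatAction K G A) {B : Type*} [Category B]
    [Preadditive B] [Linear K B] (F : A ⥤ B) : Prop where
  additive : F.Additive
  linear : F.Linear K
  left : ∀ X Y : A, (T.stabilizer X ≠ ⊤ ∨ T.stabilizer Y = ⊤) →
    Nonempty ((F.obj X ⟶ F.obj Y) ≃ₗ[K] ⨁ g : G, ((T.functor g).obj X ⟶ Y))
  right : ∀ X Y : A, (T.stabilizer Y ≠ ⊤ ∨ T.stabilizer X = ⊤) →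
    Nonempty ((F.obj X ⟶ F.obj Y) ≃ₗ[K] ⨁ g : G, (X ⟶ (T.functor g).obj Y))

end SemiCovering

/-! ### The twists `ᵍM` -/

section Twist

variable {G : Type*} [Group G] {Λ : Type u} [Ring Λ] [MulSemiringAction G Λ]

/-- The twist `ᵍM` of a `Λ`-module `M`: the same abelian group, on which `x` acts as `g • x`
acts on `M`. For vertices and arrows this says `ᵍM(i) = M(g i)` and `ᵍM(a) = M(g a)`. -/
@[nolint unusedArguments]
def TwistMod (_ : G) (M : Type*) : Type _ := M

namespace TwistMod

instance (g : G) (M : Type*) [AddCommGroup M] : AddCommGroup (TwistMod g M) :=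
  inferInstanceAs (AddCommGroup M)

instance (g : G) (M : Type*) [AddCommGroup M] [Module Λ M] : Module Λ (TwistMod g M) :=
  Module.compHom M (MulSemiringAction.toRingHom G Λ g)

theorem smul_def (g : G) {M : Type*} [AddCommGroup M] [Module Λ M] (x : Λ) (m : M) :
    (x • (show TwistMod g M from m) : TwistMod g M) = ((g • x) • m : M) := rfl

instance (g : G) (M : Type*) [AddCommGroup M] [Module Λ M] [Module.Finite Λ M] :
    Module.Finite Λ (TwistMod g M) :=
  Module.Finite.of_surjective (σ := MulSemiringAction.toRingHom G Λ g⁻¹)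
    ({ toFun := fun m => m
       map_add' := fun _ _ => rfl
       map_smul' := fun x m => by
        change x • m = (g • (g⁻¹ • x)) • m
        rw [smul_inv_smul] } : M →ₛₗ[MulSemiringAction.toRingHom G Λ g⁻¹] TwistMod g M)
    (fun m => ⟨m, rfl⟩)

/-- `ᵍf : ᵍM → ᵍN` is `f` on underlying groups. -/
def map (g : G) {M N : Type*} [AddCommGroup M] [Module Λ M] [AddCommGroup N] [Module Λ N]
    (f : M →ₗ[Λ] N) : TwistMod g M →ₗ[Λ] TwistMod g N where
  toFun := f
  map_add' := f.map_add
  map_smul' x m := f.map_smul (g • x) m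

end TwistMod

variable (Λ) in
/-- The functor `M ↦ ᵍM` on finitely generated `Λ`-modules. -/
def twist (g : G) : FGModuleCat.{v} Λ ⥤ FGModuleCat.{v} Λ where
  obj M := FGModuleCat.of Λ (TwistMod g M)
  map f := FGModuleCat.ofHom (TwistMod.map g f.hom.hom)

end Twist

section TwistAction

variable (K : Type*) [Field K] (G : Type*) [CommGroup G] (Λ : Type u) [Ring Λ] [Algebra K Λ]
  [MulSemiringAction G Λ] [SMulCommClass G K Λ]

/-- The action of an abelian group `G` on `mod Λ` by `M ↦ ᵍM`; the structure isomorphisms are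
identities on underlying groups. -/
def twistAction : LinearCatAction K G (FGModuleCat.{v} Λ) where
  functor g := twist Λ g
  additive g := ⟨rfl⟩
  linear g := ⟨fun f r => by
    ext m
    change algebraMap K Λ r • f.hom.hom m = (g • algebraMap K Λ r) • f.hom.hom m
    rw [smul_algebraMap]⟩
  oneIso := NatIso.ofComponents
    (fun M => LinearEquiv.toFGModuleCatIso
      ({ toFun := fun m => m
         invFun := fun m => m
         left_inv := fun _ => rfl
         right_inv := fun _ => rfl
         map_add' := fun _ _ => rfl
         map_smul' := fun x m => by
          change ((1 : G) • x) • (show M from m) = x • (show M from m)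
          rw [one_smul] } : TwistMod (1 : G) M ≃ₗ[Λ] M))
    (fun _ => rfl)
  mulIso {g h k} hk := NatIso.ofComponents
    (fun M => LinearEquiv.toFGModuleCatIso
      ({ toFun := fun m => m
         invFun := fun m => m
         left_inv := fun _ => rfl
         right_inv := fun _ => rfl
         map_add' := fun _ _ => rfl
         map_smul' := fun x m => by
          change (k • x) • (show M from m) = (h • (g • x)) • (show M from m)
          rw [smul_smul, mul_comm h g, hk] } : TwistMod k M ≃ₗ[Λ] TwistMod g (TwistMod h M)))
    (fun _ => rfl)
  one_mul _ _ := rfl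
  mul_one _ _ := rfl
  mul_assoc _ _ _ _ _ := FGModuleCat.hom_ext (LinearMap.ext fun _ => rfl)

end TwistAction

/-! ### The pushdown functor

The skew group algebra `ΛG` is `SkewMonoidAlgebra Λ G`: the element `x ⊗ g` is
`SkewMonoidAlgebra.single g x`, and `(x ⊗ g) (y ⊗ h) = x (g • y) ⊗ g h`. -/

section Pushdown

variable {G : Type w} [Group G] {Λ : Type u} [Ring Λ] [MulSemiringAction G Λ]

variable (G) in
/-- The underlying space `⨁_g M` of `F_λ M` (`G` is finite). An element is a family `(μ_g)`, and
`x ⊗ h` maps it to the family with `g`-th entry `(g • x) μ_{g h}`. In terms of vertices,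
the value of `F_λ M` at `i ⊗ 1` is `⨁_g M(g i)`, and for an arrow `a : i ⟶ j` the element
`a ⊗ 1` acts as `(μ_g) ↦ (M(g a) μ_g)`. See `PushdownMod.mem_vertex_iff` and
`PushdownMod.mem_fixedVertex_iff` for the values at the idempotents of `ΛG`. -/
def PushdownMod (M : Type*) : Type _ := G → M

namespace PushdownMod

instance (M : Type*) [AddCommGroup M] : AddCommGroup (PushdownMod G M) :=
  inferInstanceAs (AddCommGroup (G → M))

variable (M : Type*) [AddCommGroup M] [Module Λ M]

/-- `x ∈ Λ` acts by `(μ_g) ↦ ((g • x) μ_g)`. -/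
def coeffHom : Λ →+* AddMonoid.End (PushdownMod G M) where
  toFun x :=
    { toFun := fun μ g => (g • x) • μ g
      map_zero' := by funext g; exact smul_zero _
      map_add' := fun μ ν => by funext g; exact smul_add _ _ _ }
  map_one' := by ext μ; funext g; change (g • (1 : Λ)) • μ g = μ g; simp
  map_mul' x y := by
    ext μ; funext g; change (g • (x * y)) • μ g = (g • x) • (g • y) • μ g
    rw [smul_mul', mul_smul]
  map_zero' := by ext μ; funext g; change (g • (0 : Λ)) • μ g = 0; simp
  map_add' x y := by
    ext μ; funext g; change (g • (x + y)) • μ g = (g • x) • μ g + (g • y) • μ g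
    rw [smul_add, add_smul]

/-- `h ∈ G` acts by `(μ_g) ↦ (μ_{g h})`. -/
def groupHom : G →* AddMonoid.End (PushdownMod G M) where
  toFun h :=
    { toFun := fun μ g => μ (g * h)
      map_zero' := rfl
      map_add' := fun _ _ => rfl }
  map_one' := by ext μ; funext g; exact congrArg μ (mul_one g)
  map_mul' h k := by ext μ; funext g; exact congrArg μ (mul_assoc g h k).symm

instance : Module (SkewMonoidAlgebra Λ G) (PushdownMod G M) :=
  Module.compHom (PushdownMod G M)
    (SkewMonoidAlgebra.liftNCRingHom (coeffHom (Λ := Λ) M) (groupHom M) (by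
      intro x y
      ext μ; funext g
      change (g • y • x) • μ (g * y) = ((g * y) • x) • μ (g * y)
      rw [smul_smul]))

variable {M}

theorem single_smul_apply (h : G) (x : Λ) (μ : PushdownMod G M) (g : G) :
    (SkewMonoidAlgebra.single h x • μ) g = (g • x) • μ (g * h) := by
  exact congrFun (DFunLike.congr_fun (SkewMonoidAlgebra.liftNC_single
    (R := AddMonoid.End (PushdownMod G M)) (coeffHom (G := G) (Λ := Λ) M : Λ →+ _)
    (groupHom (G := G) M) h x) μ) g

/-- The value of `F_λ M` at `e ⊗ 1` is `⨁_g (g • e) M`: for `e = e_i` this is `⨁_g M(g i)`, which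
is the direct sum of the `M(x)` over the orbit of `i` if `i` has trivial stabilizer. -/
theorem mem_vertex_iff (e : Λ) (μ : PushdownMod G M) :
    SkewMonoidAlgebra.single (1 : G) e • μ = μ ↔ ∀ g, (g • e) • μ g = μ g := by
  have h (g : G) : (SkewMonoidAlgebra.single (1 : G) e • μ) g = (g • e) • μ g := by
    rw [single_smul_apply, mul_one]
  exact ⟨fun hμ g => by rw [← h g, hμ], fun hμ => funext fun g => by rw [h g, hμ g]⟩

instance [Finite G] [Module.Finite Λ M] :
    Module.Finite (SkewMonoidAlgebra Λ G) (PushdownMod G M) := by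
  classical
  cases nonempty_fintype G
  obtain ⟨S, hS⟩ := (Module.finite_def.mp ‹Module.Finite Λ M›)
  let ι (g : G) (m : M) : PushdownMod G M := Pi.single (M := fun _ : G => M) g m
  have hι (g : G) (x : Λ) (m : M) :
      SkewMonoidAlgebra.single (1 : G) (g⁻¹ • x) • ι g m = ι g (x • m) := by
    funext k
    rw [single_smul_apply, mul_one]
    by_cases hk : k = g
    · subst hk; simp [ι]
    · simp [ι, hk]
  let T : Finset (PushdownMod G M) := Finset.univ.biUnion fun g => S.image (ι g)
  refine Module.finite_def.mpr ⟨T, eq_top_iff.mpr fun μ _ => ?_⟩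
  have key (g : G) (m : M) : ι g m ∈ Submodule.span (SkewMonoidAlgebra Λ G) (T : Set _) := by
    have hm : m ∈ Submodule.span Λ (S : Set M) := by rw [hS]; trivial
    induction hm using Submodule.span_induction with
    | mem m hm =>
      refine Submodule.subset_span ?_
      simp only [T, Finset.coe_biUnion, Set.mem_iUnion, Finset.coe_image]
      exact ⟨g, by simp, m, hm, rfl⟩
    | zero =>
      have : ι g (0 : M) = 0 := Pi.single_zero (M := fun _ : G => M) g
      rw [this]; exact Submodule.zero_mem _
    | add a b _ _ ha hb =>
      have : ι g (a + b) = ι g a + ι g b := Pi.single_add (f := fun _ : G => M) g a b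
      rw [this]; exact Submodule.add_mem _ ha hb
    | smul x a _ ha =>
      rw [← hι]; exact Submodule.smul_mem _ _ ha
  have hμ : μ = ∑ g : G, ι g (μ g) := (Finset.univ_sum_single (M := fun _ : G => M) μ).symm
  rw [hμ]
  exact Submodule.sum_mem _ fun g _ => key g _

/-- An additive map that commutes with the elements `x ⊗ h` is `ΛG`-linear. -/
def linearOfAdd {P P' : Type*} [AddCommGroup P] [Module (SkewMonoidAlgebra Λ G) P]
    [AddCommGroup P'] [Module (SkewMonoidAlgebra Λ G) P'] (f : P →+ P')
    (hf : ∀ (h : G) (x : Λ) (p : P),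
      f (SkewMonoidAlgebra.single h x • p) = SkewMonoidAlgebra.single h x • f p) :
    P →ₗ[SkewMonoidAlgebra Λ G] P' where
  toFun := f
  map_add' := f.map_add
  map_smul' y p := by
    rw [RingHom.id_apply]
    induction y using SkewMonoidAlgebra.induction_on with
    | zero => rw [zero_smul, zero_smul, map_zero]
    | single h x => exact hf h x p
    | add x y hx hy => rw [add_smul, add_smul, map_add, hx, hy]

/-- `F_λ f` is `f` in every component. -/
def map {M N : Type*} [AddCommGroup M] [Module Λ M] [AddCommGroup N] [Module Λ N]
    (f : M →ₗ[Λ] N) : PushdownMod G M →ₗ[SkewMonoidAlgebra Λ G] PushdownMod G N :=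
  linearOfAdd
    { toFun := fun μ g => f (μ g)
      map_zero' := funext fun _ => f.map_zero
      map_add' := fun _ _ => funext fun _ => f.map_add _ _ }
    (fun h x μ => funext fun g =>
      (congrArg f (single_smul_apply h x μ g)).trans <| (f.map_smul _ _).trans
        (single_smul_apply h x (fun k => f (μ k) : PushdownMod G N) g).symm)

/-- The identification `F_λ M = F_λ (ᵍM)`, `(μ_k)_k ↦ (μ_{g k})_k`: it permutes the summands of
`⨁_k M(k i)` and `⨁_k (ᵍM)(k i) = ⨁_k M(g k i)`. -/
def shift (g : G) (M : Type*) [AddCommGroup M] [Module Λ M] :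
    PushdownMod G M ≃ₗ[SkewMonoidAlgebra Λ G] PushdownMod G (TwistMod g M) where
  __ := linearOfAdd (P := PushdownMod G M) (P' := PushdownMod G (TwistMod g M))
    { toFun := fun μ k => (μ (g * k) : M)
      map_zero' := rfl
      map_add' := fun _ _ => rfl }
    (fun h x μ => funext fun k => by
      refine (single_smul_apply h x μ (g * k)).trans ?_
      refine Eq.trans ?_ (single_smul_apply (M := TwistMod g M) h x
        (fun k => (μ (g * k) : M)) k).symm
      change ((g * k) • x) • μ (g * k * h) = (g • k • x) • μ (g * (k * h))
      rw [smul_smul, mul_assoc])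
  invFun μ k := (μ (g⁻¹ * k) : M)
  left_inv μ := funext fun k => congrArg μ (mul_inv_cancel_left g k)
  right_inv μ := funext fun k => congrArg μ (inv_mul_cancel_left g k)

end PushdownMod

variable (G Λ) in
/-- The pushdown functor `F_λ : mod Λ ⥤ mod ΛG`. -/
def pushdown [Finite G] :
    FGModuleCat.{v} Λ ⥤ FGModuleCat.{max w v} (SkewMonoidAlgebra Λ G) where
  obj M := FGModuleCat.of (SkewMonoidAlgebra Λ G) (PushdownMod G M)
  map f := FGModuleCat.ofHom (PushdownMod.map f.hom.hom)

/-- The identification `F_λ M = F_λ (ᵍM)`, as an isomorphism in `mod ΛG`. -/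
def pushdownShift [Finite G] (g : G) (M : FGModuleCat.{v} Λ) :
    (pushdown G Λ).obj M ≅ (pushdown G Λ).obj ((twist Λ g).obj M) :=
  LinearEquiv.toFGModuleCatIso (PushdownMod.shift g M)

end Pushdown

section Fixed

variable {K : Type*} [Field K] {G : Type*} [CommGroup G] [Fintype G] {Λ : Type u} [Ring Λ]
  [Algebra K Λ] [MulSemiringAction G Λ]

variable (Λ) in
/-- The idempotent `e_ρ = |G|⁻¹ ∑_g ρ(g) g` of a character `ρ` of `G`, as the element
`1 ⊗ e_ρ` of `ΛG`. -/
def charIdempotent (ρ : G →* Kˣ) : SkewMonoidAlgebra Λ G :=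
  ∑ g : G, SkewMonoidAlgebra.single g (algebraMap K Λ ((Nat.card G : K)⁻¹ * ρ g))

/-- If `e` is fixed by `G` (for instance `e = e_i` for a vertex `i` with `G_i = G`), then
`(e ⊗ 1) (1 ⊗ e_ρ)` is the idempotent of the vertex `(i, ρ)`, and the value of `F_λ M` there is a
copy of `e M = M(i)`, embedded by `m ↦ (ρ(g)⁻¹ m)_g`. -/
theorem PushdownMod.mem_fixedVertex_iff [SMulCommClass G K Λ] (hG : (Nat.card G : K) ≠ 0)
    (ρ : G →* Kˣ) (e : Λ) (hid : e * e = e) (he : ∀ g : G, g • e = e) {M : Type*} [AddCommGroup M] [Module Λ M]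
    (μ : PushdownMod G M) :
    (SkewMonoidAlgebra.single (1 : G) e * charIdempotent Λ ρ) • μ = μ ↔
      e • μ 1 = μ 1 ∧ ∀ g, μ g = algebraMap K Λ ((ρ g)⁻¹ : Kˣ) • μ 1 := by
  have hc (g : G) : (charIdempotent Λ ρ • μ) g =
      ∑ h : G, algebraMap K Λ ((Nat.card G : K)⁻¹ * ρ h) • μ (g * h) := by
    rw [charIdempotent, Finset.sum_smul]
    refine (Finset.sum_apply (M := fun _ : G => M) g Finset.univ _).trans ?_
    refine Finset.sum_congr rfl fun h _ => ?_
    rw [single_smul_apply, smul_algebraMap]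
  have hs (g : G) : ((SkewMonoidAlgebra.single (1 : G) e * charIdempotent Λ ρ) • μ) g =
      e • ∑ h : G, algebraMap K Λ ((Nat.card G : K)⁻¹ * ρ h) • μ (g * h) := by
    rw [mul_smul, single_smul_apply, he, mul_one, hc]
  have hshift (g : G) : ∑ h : G, algebraMap K Λ ((Nat.card G : K)⁻¹ * ρ h) • μ (g * h) =
      algebraMap K Λ ((ρ g)⁻¹ : Kˣ) •
        ∑ h : G, algebraMap K Λ ((Nat.card G : K)⁻¹ * ρ h) • μ (1 * h) := by
    rw [Finset.smul_sum]
    refine Fintype.sum_equiv (Equiv.mulLeft g) _ _ fun h => ?_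
    rw [Equiv.coe_mulLeft, one_mul, smul_smul, ← map_mul, map_mul ρ]
    congr 2
    push_cast
    field_simp
  have hcomm (c : K) (m : M) : e • algebraMap K Λ c • m = algebraMap K Λ c • e • m := by
    rw [smul_smul, smul_smul, Algebra.commutes]
  constructor
  · intro hμ
    have h1 (g : G) : μ g = algebraMap K Λ ((ρ g)⁻¹ : Kˣ) • μ 1 := by
      conv_lhs => rw [← hμ, hs, hshift, hcomm, ← hs 1, hμ]
    refine ⟨?_, h1⟩
    conv_lhs => rw [← hμ, hs, smul_smul, hid, ← hs, hμ]
  · rintro ⟨h1, h2⟩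
    funext g
    rw [hs, hshift, hcomm, h2 g]
    congr 1
    have hterm (h : G) : algebraMap K Λ ((Nat.card G : K)⁻¹ * ρ h) • μ (1 * h) =
        algebraMap K Λ (Nat.card G : K)⁻¹ • μ 1 := by
      rw [one_mul, h2 h, smul_smul, ← map_mul, mul_assoc, Units.mul_inv, mul_one]
    rw [Finset.sum_congr rfl fun h _ => hterm h, Finset.sum_const, Finset.card_univ,
      ← Nat.card_eq_fintype_card, ← Nat.cast_smul_eq_nsmul Λ, ← map_natCast (algebraMap K Λ),
      smul_smul (algebraMap K Λ _), ← map_mul, mul_inv_cancel₀ hG, map_one, one_smul, h1]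

end Fixed

end

/-! The statement reduces to a description of `Hom(F_λ M, F_λ N)` that holds for all `M` and `N`. A
`ΛG`-linear map `φ : F_λ M → F_λ N` commutes with the translations `μ ↦ (μ_{g h})_g`, so it is
determined by `μ ↦ (φ μ)_1`, which is a sum of additive maps `φ_g : M → N`, one for each summand of
`F_λ M = ⨁_g M`. Commutation with `x ⊗ 1` says `φ_g ((g • x) m) = x φ_g m`, that is,
`φ_g : ᵍM → N` is `Λ`-linear. Conversely `φ = ∑_g F_λ(φ_g) ι_g`. This gives `pushdownHomEquiv`.

The family `Hom(M, ᵍN)` is the family `Hom(ᵍM, N)` with `g` replaced by `g⁻¹`, because both consist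
of the additive maps `M → N` with `f (x m) = (g • x) f m`; this gives `pushdownHomEquiv'`. If every
`ᵍM` is isomorphic to `M`, precomposition with isomorphisms `θ_g : ᵍM → M` gives the third form. -/

noncomputable section

section Component

variable {G : Type*} [DecidableEq G] {M N : Type*} [AddCommGroup M] [AddCommGroup N]

/-- The element of `F_λ M = ⨁_g M` with `m` in the summand `g` and zero elsewhere. -/
def PushdownMod.single (g : G) (m : M) : PushdownMod G M := Pi.single (M := fun _ => M) g m

theorem PushdownMod.single_add (g : G) (m m' : M) :
    PushdownMod.single g (m + m') = PushdownMod.single g m + PushdownMod.single g m' :=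
  Pi.single_add (f := fun _ : G => M) g m m'

theorem PushdownMod.sum_single [Fintype G] (μ : PushdownMod G M) :
    ∑ g : G, PushdownMod.single g (μ g) = μ :=
  Finset.univ_sum_single (M := fun _ : G => M) μ

variable [Group G] {Λ : Type*} [Ring Λ] [MulSemiringAction G Λ] [Module Λ M] [Module Λ N]

theorem PushdownMod.coeff_smul_single (g : G) (x : Λ) (m : M) :
    SkewMonoidAlgebra.single (1 : G) x • PushdownMod.single g m =
      PushdownMod.single g ((g • x) • m) := by
  funext k
  rw [PushdownMod.single_smul_apply, mul_one]
  by_cases hk : k = g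
  · subst hk; simp [PushdownMod.single]
  · simp [PushdownMod.single, hk]

/-- The `g`-th component of a `ΛG`-linear map `φ : F_λ M → F_λ N`: the restriction of
`μ ↦ (φ μ)_1` to the `g`-th summand, which is `Λ`-linear on `ᵍM`. -/
def PushdownMod.component (φ : PushdownMod G M →ₗ[SkewMonoidAlgebra Λ G] PushdownMod G N) (g : G) :
    TwistMod g M →ₗ[Λ] N where
  toFun m := φ (PushdownMod.single g m) 1
  map_add' m m' := congrFun ((congrArg φ (PushdownMod.single_add (M := M) g m m')).trans
    (φ.map_add _ _)) 1
  map_smul' x m := by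
    change φ (PushdownMod.single g ((g • x) • (show M from m))) 1 = _
    rw [← PushdownMod.coeff_smul_single, map_smul, PushdownMod.single_smul_apply, one_smul,
      mul_one, RingHom.id_apply]

/-- `φ = ∑_g F_λ(φ_g) ι_g`, evaluated at an element: translation by `k` reduces the entry at `k`
to the entry at `1`. -/
theorem PushdownMod.apply_eq_sum_component [Fintype G]
    (φ : PushdownMod G M →ₗ[SkewMonoidAlgebra Λ G] PushdownMod G N) (μ : PushdownMod G M) (k : G) :
    φ μ k = ∑ g : G, PushdownMod.component φ g (μ (g * k)) := by
  have h : φ μ k = φ (SkewMonoidAlgebra.single k (1 : Λ) • μ) 1 := by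
    rw [map_smul, PushdownMod.single_smul_apply, smul_one, one_smul, one_mul]
  rw [h, ← PushdownMod.sum_single (SkewMonoidAlgebra.single k (1 : Λ) • μ), map_sum]
  refine (Finset.sum_apply (M := fun _ : G => N) 1 Finset.univ _).trans ?_
  refine Finset.sum_congr rfl fun g _ => ?_
  rw [PushdownMod.single_smul_apply, smul_one, one_smul]
  rfl

end Component

section HomSpaces

variable {K : Type*} [Field K] {G : Type w} [Group G] [Fintype G] {Λ : Type u} [Ring Λ]
  [Algebra K Λ] [MulSemiringAction G Λ] [SMulCommClass G K Λ]

instance pushdown_additive : (pushdown.{v} G Λ).Additive where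
  map_add := rfl

variable (K) in
theorem pushdown_linear : (pushdown.{v} G Λ).Linear K where
  map_smul {M N} f r := by
    refine FGModuleCat.hom_ext (LinearMap.ext fun μ => funext fun k => ?_)
    change algebraMap K Λ r • f.hom.hom (μ k) =
      (algebraMap K (SkewMonoidAlgebra Λ G) r • PushdownMod.map f.hom.hom μ) k
    rw [show algebraMap K (SkewMonoidAlgebra Λ G) r =
      SkewMonoidAlgebra.single (1 : G) (algebraMap K Λ r) from rfl,
      PushdownMod.single_smul_apply, smul_algebraMap, mul_one]
    rfl

variable (G Λ) in
theorem pushdown_sum_apply {M N : FGModuleCat.{v} Λ} (s : Finset G)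
    (φ : G → ((pushdown G Λ).obj M ⟶ (pushdown G Λ).obj N)) (μ : PushdownMod G M) (k : G) :
    (show PushdownMod G N from (∑ g ∈ s, φ g).hom.hom μ) k =
      ∑ g ∈ s, (show PushdownMod G N from (φ g).hom.hom μ) k := by
  classical
  induction s using Finset.induction_on with
  | empty => rfl
  | insert g s hg ih =>
    rw [Finset.sum_insert hg, Finset.sum_insert hg, ← ih]
    rfl

variable (K) in
/-- `∏_g Hom(ᵍM, N) ≃ Hom(F_λ M, F_λ N)`, with inverse `φ ↦ (φ_g)_g`. -/
def pushdownHomEquiv (M N : FGModuleCat.{v} Λ) :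
    (∀ g : G, ((twist Λ g).obj M ⟶ N)) ≃ₗ[K] ((pushdown G Λ).obj M ⟶ (pushdown G Λ).obj N) :=
  letI := Classical.decEq G
  { toFun := fun f => ∑ g : G, (pushdownShift g M).hom ≫ (pushdown G Λ).map (f g)
    map_add' := fun f f' => by
      simp only [Pi.add_apply, Functor.map_add, Preadditive.comp_add, Finset.sum_add_distrib]
    map_smul' := fun r f => by
      have := pushdown_linear.{v} (G := G) (Λ := Λ) K
      simp only [Pi.smul_apply, Functor.map_smul, Linear.comp_smul, Finset.smul_sum,
        RingHom.id_apply]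
    invFun := fun φ g => FGModuleCat.ofHom (PushdownMod.component φ.hom.hom g)
    left_inv := fun f => by
      funext g
      refine FGModuleCat.hom_ext (LinearMap.ext fun m => ?_)
      refine (pushdown_sum_apply G Λ Finset.univ
        (fun h => (pushdownShift h M).hom ≫ (pushdown G Λ).map (f h))
        (PushdownMod.single g m) 1).trans ?_
      change ∑ h : G, (f h).hom.hom (PushdownMod.single (M := M) g m (h * 1)) = _
      rw [Finset.sum_eq_single g]
      · rw [mul_one]
        exact congrArg (f g).hom.hom (Pi.single_eq_same (M := fun _ : G => M) g m)
      · intro h _ hh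
        rw [mul_one]
        exact (congrArg (f h).hom.hom (Pi.single_eq_of_ne (M := fun _ : G => M) hh m)).trans
          (map_zero (f h).hom.hom)
      · simp
    right_inv := fun φ => by
      refine FGModuleCat.hom_ext (LinearMap.ext fun μ => funext fun k => ?_)
      refine (pushdown_sum_apply G Λ Finset.univ _ μ k).trans ?_
      exact (PushdownMod.apply_eq_sum_component φ.hom.hom μ k).symm }

theorem pushdownHomEquiv_apply (M N : FGModuleCat.{v} Λ) (f : ∀ g : G, ((twist Λ g).obj M ⟶ N)) :
    pushdownHomEquiv K M N f = ∑ g : G, (pushdownShift g M).hom ≫ (pushdown G Λ).map (f g) := rfl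

variable (K) in
/-- `Hom(M, ᵍN) = Hom(ᵏM, N)` for `k = g⁻¹`, as sets of additive maps. -/
def twistHomEquiv {g k : G} (h : g * k = 1) (M N : FGModuleCat.{v} Λ) :
    (M ⟶ (twist Λ g).obj N) ≃ₗ[K] ((twist Λ k).obj M ⟶ N) where
  toFun f := FGModuleCat.ofHom
    ({ toFun := fun m => f.hom.hom m
       map_add' := f.hom.hom.map_add
       map_smul' := fun x m => by
        refine (f.hom.hom.map_smul (k • x) m).trans ?_
        change (g • k • x) • (show N from f.hom.hom m) = x • (show N from f.hom.hom m)
        rw [smul_smul, h, one_smul] } : TwistMod k M →ₗ[Λ] N)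
  invFun f := FGModuleCat.ofHom
    ({ toFun := fun m => f.hom.hom m
       map_add' := f.hom.hom.map_add
       map_smul' := fun x m => by
        refine Eq.trans ?_ (f.hom.hom.map_smul (g • x) m)
        change f.hom.hom (x • (show M from m)) = f.hom.hom ((k • g • x) • (show M from m))
        rw [smul_smul, mul_eq_one_comm.mp h, one_smul] } : M →ₗ[Λ] TwistMod g N)
  map_add' _ _ := rfl
  map_smul' r f := by
    refine FGModuleCat.hom_ext (LinearMap.ext fun m => ?_)
    change (g • algebraMap K Λ r) • (show N from f.hom.hom m) =
      algebraMap K Λ r • (show N from f.hom.hom m)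
    rw [smul_algebraMap]
  left_inv _ := rfl
  right_inv _ := rfl

theorem shift_comp_map_twistHomEquiv (g : G) {M N : FGModuleCat.{v} Λ}
    (f : M ⟶ (twist Λ g).obj N) :
    (pushdownShift g⁻¹ M).hom ≫
        (pushdown G Λ).map (twistHomEquiv K (mul_inv_cancel g) M N f) =
      (pushdown G Λ).map f ≫ (pushdownShift g N).inv := rfl

variable (K) in
/-- `∏_g Hom(M, ᵍN) ≃ Hom(F_λ M, F_λ N)`. -/
def pushdownHomEquiv' (M N : FGModuleCat.{v} Λ) :
    (∀ g : G, (M ⟶ (twist Λ g).obj N)) ≃ₗ[K] ((pushdown G Λ).obj M ⟶ (pushdown G Λ).obj N) :=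
  LinearEquiv.piCongrRight
      (fun g => twistHomEquiv K (k := Equiv.inv G g) (mul_inv_cancel g) M N) ≪≫ₗ
    (LinearEquiv.piCongrLeft K (fun g : G => (twist Λ g).obj M ⟶ N) (Equiv.inv G)) ≪≫ₗ
    pushdownHomEquiv K M N

theorem pushdownHomEquiv'_apply (M N : FGModuleCat.{v} Λ) (f : ∀ g : G, (M ⟶ (twist Λ g).obj N)) :
    pushdownHomEquiv' K M N f = ∑ g : G, (pushdown G Λ).map (f g) ≫ (pushdownShift g N).inv := by
  rw [pushdownHomEquiv', LinearEquiv.trans_apply, LinearEquiv.trans_apply, pushdownHomEquiv_apply,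
    ← Equiv.sum_comp (Equiv.inv G)]
  refine Finset.sum_congr rfl fun g _ => ?_
  rw [← shift_comp_map_twistHomEquiv (K := K)]
  congr 2
  exact Equiv.piCongrLeft_apply_apply (P := fun g : G => (twist Λ g).obj M ⟶ N) (Equiv.inv G)
    (fun g => twistHomEquiv K (k := Equiv.inv G g) (mul_inv_cancel g) M N (f g)) g

end HomSpaces

end

theorem theorem3p9
    -- an algebraically closed field, a finite quiver, a finite abelian group of invertible order
    {K : Type*} [Field K] [IsAlgClosed K]
    {Q : Type*} [Fintype Q] [Quiver.{a + 1} Q] [∀ i j : Q, Finite (i ⟶ j)]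
    {G : Type w} [CommGroup G] [Fintype G] (hG : (Nat.card G : K) ≠ 0)
    -- the action of `G` on `KQ`
    [MulAction G Q] [MulSemiringAction G (PathAlgebra K Q)] [SMulCommClass G K (PathAlgebra K Q)]
    (hQ : PathAlgebra.IsQuiverAction K Q G)
    -- the algebra `Λ = KQ / I` for a `G`-stable admissible ideal `I`, with the induced action
    {Λ : Type u} [Ring Λ] [Algebra K Λ] [MulSemiringAction G Λ] [SMulCommClass G K Λ]
    (π : PathAlgebra K Q →ₐ[K] Λ) (hπ : Function.Surjective π)
    (hI : PathAlgebra.IsAdmissible (TwoSidedIdeal.ker π))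
    (hπG : ∀ (g : G) (x : PathAlgebra K Q), π (g • x) = g • π x) :
    (∀ M N : FGModuleCat.{v} Λ,
      ((twistAction K G Λ).stabilizer M ≠ ⊤ →
        ∃ e : (⨁ g : G, ((twist Λ g).obj M ⟶ N)) ≃ₗ[K]
            ((pushdown G Λ).obj M ⟶ (pushdown G Λ).obj N),
          ∀ f, e f = ∑ g : G, (pushdownShift g M).hom ≫ (pushdown G Λ).map (f g)) ∧
      ((twistAction K G Λ).stabilizer N ≠ ⊤ →
        ∃ e : (⨁ g : G, (M ⟶ (twist Λ g).obj N)) ≃ₗ[K]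
            ((pushdown G Λ).obj M ⟶ (pushdown G Λ).obj N),
          ∀ f, e f = ∑ g : G, (pushdown G Λ).map (f g) ≫ (pushdownShift g N).inv) ∧
      ((twistAction K G Λ).stabilizer M ⊓ (twistAction K G Λ).stabilizer N = ⊤ →
        ∃ (θ : ∀ g : G, (twist Λ g).obj M ≅ M)
          (e : (⨁ _g : G, (M ⟶ N)) ≃ₗ[K] ((pushdown G Λ).obj M ⟶ (pushdown G Λ).obj N)),
          ∀ f, e f =
            ∑ g : G, (pushdownShift g M).hom ≫ (pushdown G Λ).map ((θ g).hom ≫ f g))) ∧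
    IsGaloisSemiCovering (twistAction.{v} K G Λ) (pushdown.{v} G Λ) := by
  classical
  refine ⟨fun M N => ⟨fun _ => ?_, fun _ => ?_, fun h => ?_⟩, ?_⟩
  · exact ⟨DirectSum.linearEquivFunOnFintype K G _ ≪≫ₗ pushdownHomEquiv K M N, fun _ => rfl⟩
  · exact ⟨DirectSum.linearEquivFunOnFintype K G _ ≪≫ₗ pushdownHomEquiv' K M N,
      fun _ => pushdownHomEquiv'_apply M N _⟩
  · have hM (g : G) : Nonempty ((twist Λ g).obj M ≅ M) := by
      have hg : g ∈ (twistAction K G Λ).stabilizer M ⊓ (twistAction K G Λ).stabilizer N :=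
        h ▸ Subgroup.mem_top g
      exact hg.1
    let θ (g : G) : (twist Λ g).obj M ≅ M := (hM g).some
    exact ⟨θ, DirectSum.linearEquivFunOnFintype K G _ ≪≫ₗ
      LinearEquiv.piCongrRight (fun g => Linear.homCongr K (θ g).symm (Iso.refl N)) ≪≫ₗ
        pushdownHomEquiv K M N, fun f => by
          simp [pushdownHomEquiv_apply, Linear.homCongr_apply]⟩
  · exact ⟨pushdown_additive, pushdown_linear K,
      fun M N _ =>
        ⟨(DirectSum.linearEquivFunOnFintype K G _ ≪≫ₗ pushdownHomEquiv K M N).symm⟩,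
      fun M N _ =>
        ⟨(DirectSum.linearEquivFunOnFintype K G _ ≪≫ₗ pushdownHomEquiv' K M N).symm⟩⟩
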